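/- Let $n\ge 1$ and let $P\subset\mathbb R^n$ be an $n$-dimensional lattice polytope (the convex hull of finitely many points of $\mathbb Z^n$, with affine span $\mathbb R^n$). Write $P=\bigcap_{i=1}^r\{x:\langle\rho_i,x\rangle\ge -a_i\}$, where the $\rho_i\in\mathbb Z^n$ are the primitive inner normals of the facets of $P$ and $a_i\in\mathbb Z$. Assume that $P$ is smooth, i.e. at every vertex exactly $n$ facets meet and their primitive inner normals form a basis of $\mathbb Z^n$. For an integer $s\ge 1$ put $P^{(s)}=\bigcap_{i=1}^r\{x:\langle\rho_i,x\rangle\ge -a_i+s\}$. Call $P$ $s$-spanned if, for every vertex $m$ of $P$, the point $m(s)$ defined by $\langle\rho_i,m(s)\rangle=-a_i+s$ for all $i$ with $\langle\rho_i,m\rangle=-a_i$ lies in $P^{(s)}$. The same notions are used for the dilates $aP$, $a\ge 1$ an integer. With $a,b,k$ ranging over the positive integers, define $$\operatorname{codeg}(P)=\min\{k : (kP)^{(1)}\cap\mathbb Z^n\ne\emptyset\},$$ $$\operatorname{codeg}_{\mathbb Q}(P)=\inf\{\tfrac ab : (aP)^{(b)}\ne\emptyset\},\qquad \tau(P)=\inf\{\tfrac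 ab : aP\text{ is }b\text{-spanned}\}.$$ Let $\Delta_n$ be the convex hull of $0,e_1,\dots,e_n$ in $\mathbb R^n$, and write $P\cong\Delta_n$ if $P$ is mapped onto $\Delta_n$ by a map $x\mapsto Ux+t$ with $U\in\mathrm{GL}_n(\mathbb Z)$ and $t\in\mathbb Z^n$. Then the three sets above are non-empty, and: (1) $\operatorname{codeg}(P)=\operatorname{codeg}_{\mathbb Q}(P)=\tau(P)=n+1$ if and only if $P\cong\Delta_n$; (2) if $P\not\cong\Delta_n$, then $\operatorname{codeg}_{\mathbb Q}(P)\le\tau(P)\le n$. -/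

import Mathlib

open scoped Pointwise

namespace LatticePolytope

/-- The integer vector `z`, viewed as a point of `ℝⁿ`. -/
def toReal {n : ℕ} (z : Fin n → ℤ) : Fin n → ℝ := fun i => (z i : ℝ)

/-- The pairing `⟨ρ, x⟩` of an integer covector `ρ` with a point `x` of `ℝⁿ`. -/
def pairing {n : ℕ} (ρ : Fin n → ℤ) (x : Fin n → ℝ) : ℝ := ∑ i, (ρ i : ℝ) * x i

/-- `P` is an `n`-dimensional lattice polytope in `ℝⁿ`: the convex hull of finitely many integer
points, which affinely spans `ℝⁿ`. -/
structure IsFullDimLatticePolytope {n : ℕ} (P : Set (Fin n → ℝ)) : Prop where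
  eq_hull : ∃ V : Finset (Fin n → ℤ), P = convexHull ℝ (toReal '' (V : Set (Fin n → ℤ)))
  spans : affineSpan ℝ P = ⊤

/-- `ρ` is the primitive inner normal vector of a facet of `P ⊆ ℝⁿ`, and
`{x | ⟨ρ, x⟩ = c}` is the corresponding supporting hyperplane: `P` lies in the half space
`{x | c ≤ ⟨ρ, x⟩}`, and the face that the hyperplane cuts out is non-empty of dimension
`n - 1`. -/
structure IsFacet {n : ℕ} (P : Set (Fin n → ℝ)) (ρ : Fin n → ℤ) (c : ℝ) : Prop where
  primitive : Finset.univ.gcd ρ = 1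
  le_pairing : ∀ x ∈ P, c ≤ pairing ρ x
  face_nonempty : {x ∈ P | pairing ρ x = c}.Nonempty
  face_dim : Module.finrank ℝ (vectorSpan ℝ {x ∈ P | pairing ρ x = c}) + 1 = n

/-- The primitive inner normals of the facets of `P` that contain the point `m`. -/
def normalsAt {n : ℕ} (P : Set (Fin n → ℝ)) (m : Fin n → ℝ) : Set (Fin n → ℤ) :=
  {ρ | IsFacet P ρ (pairing ρ m)}

/-- `P` is smooth (a Delzant polytope): at every vertex, the primitive inner normals of the facets
through it form a basis of the lattice `ℤⁿ`; in particular exactly `n` facets meet there. -/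
def IsSmooth {n : ℕ} (P : Set (Fin n → ℝ)) : Prop :=
  ∀ m ∈ Set.extremePoints ℝ P,
    ∃ b : Module.Basis (Fin n) ℤ (Fin n → ℤ), Set.range b = normalsAt P m

/-- The polytope `P^(s)`, obtained by moving every facet hyperplane of `P` inwards by lattice
distance `s`. -/
def shrink {n : ℕ} (P : Set (Fin n → ℝ)) (s : ℕ) : Set (Fin n → ℝ) :=
  {x | ∀ ρ c, IsFacet P ρ c → c + s ≤ pairing ρ x}

/-- `P` is `s`-spanned at the vertex `m`: the point `m(s)` in which the facet hyperplanes
through `m` meet after they have been moved inwards by `s` lies in `P^(s)`. For a smooth `P`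
the point `m(s)` is determined by the equations below. -/
def IsSpannedAt {n : ℕ} (P : Set (Fin n → ℝ)) (s : ℕ) (m : Fin n → ℝ) : Prop :=
  ∃ y ∈ shrink P s, ∀ ρ ∈ normalsAt P m, pairing ρ y = pairing ρ m + s

/-- `P` is `s`-spanned: it is so at every vertex. -/
def IsSpanned {n : ℕ} (P : Set (Fin n → ℝ)) (s : ℕ) : Prop :=
  ∀ m ∈ Set.extremePoints ℝ P, IsSpannedAt P s m

/-- The positive integers `k` such that `(kP)^(1)` contains a lattice point. -/
def codegSet {n : ℕ} (P : Set (Fin n → ℝ)) : Set ℕ :=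
  {k | 0 < k ∧ ∃ z : Fin n → ℤ, toReal z ∈ shrink ((k : ℝ) • P) 1}

/-- The codegree of `P`. -/
noncomputable def codeg {n : ℕ} (P : Set (Fin n → ℝ)) : ℕ := sInf (codegSet P)

/-- The positive rational numbers `a / b` such that `(aP)^(b)` is non-empty. -/
def codegQSet {n : ℕ} (P : Set (Fin n → ℝ)) : Set ℝ :=
  {q | ∃ a b : ℕ, 0 < a ∧ 0 < b ∧ (shrink ((a : ℝ) • P) b).Nonempty ∧ q = (a : ℝ) / b}

/-- The `ℚ`-codegree of `P`. -/
noncomputable def codegQ {n : ℕ} (P : Set (Fin n → ℝ)) : ℝ := sInf (codegQSet P)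

/-- The positive rational numbers `a / b` such that `aP` is `b`-spanned. -/
def nefSet {n : ℕ} (P : Set (Fin n → ℝ)) : Set ℝ :=
  {q | ∃ a b : ℕ, 0 < a ∧ 0 < b ∧ IsSpanned ((a : ℝ) • P) b ∧ q = (a : ℝ) / b}

/-- The nef value `τ(P)` of `P`. -/
noncomputable def nefValue {n : ℕ} (P : Set (Fin n → ℝ)) : ℝ := sInf (nefSet P)

/-- The standard simplex `Δₙ`, the convex hull of `0, e₁, …, eₙ` in `ℝⁿ`. -/
def unitSimplex (n : ℕ) : Set (Fin n → ℝ) :=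
  convexHull ℝ (insert 0 (Set.range fun i : Fin n => (Pi.single i 1 : Fin n → ℝ)))

/-- `P` and `Q` are the same lattice polytope up to the choice of affine lattice coordinates: an
affine map `x ↦ U x + t` with `U ∈ GL(n, ℤ)` and `t ∈ ℤⁿ` maps `P` onto `Q`. -/
def LatticeEquivalent {n : ℕ} (P Q : Set (Fin n → ℝ)) : Prop :=
  ∃ (U : Matrix.GeneralLinearGroup (Fin n) ℤ) (t : Fin n → ℤ),
    (fun x => Matrix.mulVec ((U : Matrix (Fin n) (Fin n) ℤ).map fun z => (z : ℝ)) x + toReal t) '' P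
      = Q

end LatticePolytope

open scoped Pointwise

namespace LatticePolytope

/-! Everything is read off at a vertex `m`, in the lattice basis `b` of facet normals there and the
dual basis `u` of primitive edge vectors. The shifted vertex of `kP` is `k m + ∑ u_j`. The geometric
input is `add_dual_mem`: each `m + u_j` lies in `P`. Hence, if a facet with normal `ρ` has lattice
distance `h` from `m`, then `⟨ρ, u_j⟩ ≥ -h` for all `j`.

The shifted vertex lies at distance `k h + ∑ ⟨ρ, u_j⟩` from the corresponding facet hyperplane of
`kP`, and spannedness asks that this be at least 1. If `h = 0`, then `ρ` is some `b_i` and the sum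
is 1. If `h ≥ 1`, then `k = n + 1` leaves at least `h`; so `n + 1` lies in all three sets. With `k =
n` the bound can fail only if every `⟨ρ, u_j⟩ = -h`. Then `ρ = -h ∑ b_j`, primitivity gives `h = 1`,
and `P` is squeezed onto the unit simplex with vertices `m` and `m + u_j`. So `τ(P) ≤ n` for every
other `P`.

For the simplex itself the `n + 1` facet normals sum to zero and the facet constants to `-1`. Adding
the shifted inequalities gives `(n + 1) b ≤ a` whenever `(aP)^(b)` is non-empty, so all three
invariants are at least `n + 1`. The spanned ratios `a / b` lie in the set defining the
`ℚ`-codegree, whence `codeg_ℚ ≤ τ`. -/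

/-- The pairing with an integer covector, as a linear functional. -/
def pairingMap {n : ℕ} (ρ : Fin n → ℤ) : Module.Dual ℝ (Fin n → ℝ) where
  toFun := pairing ρ
  map_add' x y := by simp [pairing, mul_add, Finset.sum_add_distrib]
  map_smul' r x := by
    simp only [pairing, Finset.mul_sum, Pi.smul_apply, smul_eq_mul, RingHom.id_apply]
    exact Finset.sum_congr rfl fun i _ => by ring

/-! ### Linear algebra of the integral pairing -/

section Pairing

variable {n : ℕ}

@[simp] theorem pairingMap_apply (ρ : Fin n → ℤ) (x : Fin n → ℝ) :
    pairingMap ρ x = pairing ρ x := rfl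

theorem pairing_add (ρ : Fin n → ℤ) (x y : Fin n → ℝ) :
    pairing ρ (x + y) = pairing ρ x + pairing ρ y := (pairingMap ρ).map_add x y

theorem pairing_sub (ρ : Fin n → ℤ) (x y : Fin n → ℝ) :
    pairing ρ (x - y) = pairing ρ x - pairing ρ y := (pairingMap ρ).map_sub x y

theorem pairing_smul (ρ : Fin n → ℤ) (r : ℝ) (x : Fin n → ℝ) :
    pairing ρ (r • x) = r * pairing ρ x := (pairingMap ρ).map_smul r x

theorem pairing_sum {ι : Type*} (s : Finset ι) (ρ : Fin n → ℤ) (x : ι → Fin n → ℝ) :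
    pairing ρ (∑ i ∈ s, x i) = ∑ i ∈ s, pairing ρ (x i) := map_sum (pairingMap ρ) x s

theorem sum_smul_pairing {ι : Type*} (s : Finset ι) (k : ι → ℤ) (ρ : ι → Fin n → ℤ)
    (x : Fin n → ℝ) :
    pairing (∑ i ∈ s, k i • ρ i) x = ∑ i ∈ s, (k i : ℝ) * pairing (ρ i) x := by
  simp only [pairing, Finset.mul_sum, Finset.sum_apply, Pi.smul_apply, smul_eq_mul, Int.cast_sum,
    Int.cast_mul, Finset.sum_mul]
  rw [Finset.sum_comm]
  exact Finset.sum_congr rfl fun i _ => Finset.sum_congr rfl fun j _ => by ring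

theorem neg_pairing (ρ : Fin n → ℤ) (x : Fin n → ℝ) : pairing (-ρ) x = -pairing ρ x := by
  simp [pairing]

theorem pairing_toReal (ρ z : Fin n → ℤ) : pairing ρ (toReal z) = ((ρ ⬝ᵥ z : ℤ) : ℝ) := by
  simp [pairing, toReal, dotProduct]

theorem toReal_add (y z : Fin n → ℤ) : toReal (y + z) = toReal y + toReal z := by
  ext i; simp [toReal]

theorem toReal_sub (y z : Fin n → ℤ) : toReal (y - z) = toReal y - toReal z := by
  ext i; simp [toReal]

theorem toReal_smul (k : ℤ) (z : Fin n → ℤ) : toReal (k • z) = (k : ℝ) • toReal z := by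
  ext i; simp [toReal]

theorem toReal_sum {ι : Type*} (s : Finset ι) (z : ι → Fin n → ℤ) :
    toReal (∑ i ∈ s, z i) = ∑ i ∈ s, toReal (z i) := by
  ext i; simp [toReal]

theorem toReal_single (i : Fin n) : toReal (Pi.single i 1) = Pi.single i 1 := by
  ext j
  by_cases h : j = i
  · subst h; simp [toReal]
  · simp [toReal, h]

theorem pairing_single (ρ : Fin n → ℤ) (i : Fin n) : pairing ρ (Pi.single i 1) = ρ i := by
  rw [← toReal_single, pairing_toReal]; simp

theorem pairingMap_eq_zero {ρ : Fin n → ℤ} (h : pairingMap ρ = 0) : ρ = 0 := by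
  ext i
  have := congrArg (fun f => f (Pi.single i 1)) h
  simpa [pairing_single] using this

theorem gcd_eq_one_of_dotProduct {ρ u : Fin n → ℤ} (h : ρ ⬝ᵥ u = 1) :
    Finset.univ.gcd ρ = 1 := by
  have h1 : Finset.univ.gcd ρ ∣ 1 := by
    rw [← h]
    exact Finset.dvd_sum fun i hi => (Finset.gcd_dvd hi).mul_right _
  rw [← Finset.normalize_gcd]
  exact normalize_eq_one.2 (isUnit_of_dvd_one h1)

end Pairing

/-! ### From supporting functionals to facets -/

/-- A functional that is non-negative on a spanning finite set and negative at `x` can be chosen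
so that its zeros in the set, together with `x`, span the space. -/
theorem exists_dual_span_insert_zeros {E : Type*} [AddCommGroup E] [Module ℝ E]
    [DecidableEq E] (D : Finset E) (hD : Submodule.span ℝ (D : Set E) = ⊤) (x : E)
    (f : Module.Dual ℝ E) (hf : ∀ d ∈ D, 0 ≤ f d) (hx : f x < 0) :
    ∃ g : Module.Dual ℝ E, (∀ d ∈ D, 0 ≤ g d) ∧ g x < 0 ∧
      Submodule.span ℝ (insert x {d | d ∈ D ∧ g d = 0}) = ⊤ := by
  induction hk : (D.filter fun d => f d ≠ 0).card using Nat.strong_induction_on generalizing f with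
  | _ k ih =>
  -- If the zeros of `f` and `x` do not span, some `σ` kills them all and is negative somewhere on
  -- `D`. Tilting `f` along `σ` keeps the old zeros and the value at `x`.
  by_cases htop : Submodule.span ℝ (insert x {d | d ∈ D ∧ f d = 0}) = ⊤
  · exact ⟨f, hf, hx, htop⟩
  obtain ⟨s, hs0, hs⟩ := Submodule.exists_le_ker_of_lt_top _ (lt_top_iff_ne_top.2 htop)
  obtain ⟨σ, hσx, hσZ, hσneg⟩ : ∃ σ : Module.Dual ℝ E, σ x = 0 ∧ (∀ d ∈ D, f d = 0 → σ d = 0) ∧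
      ∃ d ∈ D, σ d < 0 := by
    have hsx : s x = 0 := hs (Submodule.subset_span (Set.mem_insert _ _))
    have hsZ : ∀ d ∈ D, f d = 0 → s d = 0 := fun d hd h0 =>
      hs (Submodule.subset_span (Set.mem_insert_of_mem _ ⟨hd, h0⟩))
    obtain ⟨d, hd, hne⟩ : ∃ d ∈ D, s d ≠ 0 := by
      by_contra! h
      exact hs0 (LinearMap.ext_on hD fun d hd => by simpa using h d hd)
    rcases lt_or_gt_of_ne hne with h | h
    · exact ⟨s, hsx, hsZ, d, hd, h⟩
    · exact ⟨-s, by simp [hsx], fun d hd h0 => by simp [hsZ d hd h0], d, hd, by simpa using h⟩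
  -- Ratio test: the least `t` at which `f + t σ` acquires a new zero in `D`. Up to there it stays
  -- non-negative, and the number of non-zero values drops.
  obtain ⟨d₀, hd₀, hmin⟩ := (D.filter fun d => σ d < 0).exists_min_image (fun d => f d / -σ d)
    (let ⟨d, hd, h⟩ := hσneg; ⟨d, Finset.mem_filter.2 ⟨hd, h⟩⟩)
  rw [Finset.mem_filter] at hd₀
  have hd₀neg : 0 < -σ d₀ := neg_pos.2 hd₀.2
  have hfd₀ : f d₀ ≠ 0 := fun h => hd₀.2.ne (hσZ d₀ hd₀.1 h)
  set t := f d₀ / -σ d₀ with ht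
  have ht0 : 0 ≤ t := div_nonneg (hf _ hd₀.1) hd₀neg.le
  refine ih _ ?_ (f + t • σ) ?_ ?_ rfl
  · rw [← hk]
    refine Finset.card_lt_card (Finset.ssubset_iff_of_subset ?_ |>.2 ⟨d₀, ?_, ?_⟩)
    · intro d
      simp only [Finset.mem_filter, and_imp]
      refine fun hd h => ⟨hd, fun h0 => h ?_⟩
      simp [h0, hσZ d hd h0]
    · simp [hd₀.1, hfd₀]
    · have : f d₀ + t * σ d₀ = 0 := by
        rw [ht]; have := hd₀.2.ne; field_simp; ring
      simp [this]
  · intro d hd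
    simp only [LinearMap.add_apply, LinearMap.smul_apply, smul_eq_mul]
    rcases le_or_gt 0 (σ d) with h | h
    · exact add_nonneg (hf d hd) (mul_nonneg ht0 h)
    · have := hmin d (Finset.mem_filter.2 ⟨hd, h⟩)
      rw [le_div_iff₀ (neg_pos.2 h)] at this
      linarith
  · simpa [hσx] using hx

/-- A functional that vanishes on integer vectors spanning a hyperplane is a multiple of the
pairing with a primitive integer covector. -/
theorem exists_primitive_of_span {n : ℕ} (Z : Set (Fin n → ℤ)) (x : Fin n → ℤ)
    (f : Module.Dual ℝ (Fin n → ℝ)) (hZ : ∀ z ∈ Z, f (toReal z) = 0) (hx : f (toReal x) < 0)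
    (hspan : Submodule.span ℝ (insert (toReal x) (toReal '' Z)) = ⊤) :
    ∃ ρ : Fin n → ℤ, Finset.univ.gcd ρ = 1 ∧ ∃ r : ℝ, 0 < r ∧ ∀ y, f y = r * pairing ρ y := by
  have hle : Submodule.span ℝ (toReal '' Z) ≤ LinearMap.ker f := by
    rw [Submodule.span_le]; rintro _ ⟨z, hz, rfl⟩; exact hZ z hz
  have hne : Submodule.span ℝ (toReal '' Z) ≠ ⊤ := fun h => by
    rw [h] at hle
    exact hx.ne (hle (Submodule.mem_top : toReal x ∈ _))
  have hlt := Submodule.finrank_lt hne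
  rw [Module.finrank_fin_fun] at hlt
  obtain ⟨g, hgZ, hgspan, -⟩ := Submodule.exists_fun_fin_finrank_span_eq ℝ (toReal '' Z)
  choose z hz hzg using hgZ
  generalize Module.finrank ℝ (Submodule.span ℝ (toReal '' Z)) = k at *
  -- Fewer than `n` spanning integer vectors, padded with zero rows to a singular square matrix,
  -- have a common integral kernel vector. Dividing it by its gcd gives `ρ` up to sign.
  let M : Matrix (Fin n) (Fin n) ℤ := fun i => if h : i.1 < k then z ⟨i, h⟩ else 0
  have hdet : M.det = 0 := Matrix.det_eq_zero_of_row_eq_zero ⟨k, hlt⟩ fun j => by simp [M]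
  obtain ⟨v, hv0, hv⟩ := Matrix.exists_mulVec_eq_zero_iff.2 hdet
  have hn : (Finset.univ : Finset (Fin n)).Nonempty := ⟨⟨k, hlt⟩, Finset.mem_univ _⟩
  obtain ⟨ρ, hρ, hgcd⟩ := Finset.extract_gcd v hn
  have hg0 : Finset.univ.gcd v ≠ 0 := fun h => hv0 (funext fun i => by
    simpa [h] using hρ i (Finset.mem_univ i))
  have hρz : ∀ y ∈ Submodule.span ℝ (toReal '' Z), pairing ρ y = 0 := by
    have : Submodule.span ℝ (toReal '' Z) ≤ LinearMap.ker (pairingMap ρ) := by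
      rw [← hgspan, Submodule.span_le]
      rintro _ ⟨i, rfl⟩
      have h1 := congrFun hv ⟨i, i.2.trans hlt⟩
      have h2 : z i ⬝ᵥ v = 0 := by simpa [Matrix.mulVec, M] using h1
      have h3 : v = Finset.univ.gcd v • ρ := funext fun i => hρ i (Finset.mem_univ i)
      rw [h3, dotProduct_smul, smul_eq_mul, mul_eq_zero, or_iff_right hg0, dotProduct_comm] at h2
      simp [← hzg, pairing_toReal, h2]
    exact fun y hy => this hy
  have key : ∀ ρ' : Fin n → ℤ, Finset.univ.gcd ρ' = 1 →
      (∀ y ∈ Submodule.span ℝ (toReal '' Z), pairing ρ' y = 0) → pairing ρ' (toReal x) < 0 →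
      ∃ r : ℝ, 0 < r ∧ ∀ y, f y = r * pairing ρ' y := by
    intro ρ' _ h0 hneg
    refine ⟨f (toReal x) / pairing ρ' (toReal x), div_pos_of_neg_of_neg hx hneg, fun y => ?_⟩
    have : f = (f (toReal x) / pairing ρ' (toReal x)) • pairingMap ρ' := by
      refine LinearMap.ext_on hspan ?_
      rintro _ (rfl | hy)
      · simp [hneg.ne]
      · have := hle (Submodule.subset_span hy)
        rw [LinearMap.mem_ker] at this
        simp [this, h0 _ (Submodule.subset_span hy)]
    conv_lhs => rw [this]
    simp
  rcases lt_trichotomy (pairing ρ (toReal x)) 0 with h | h | h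
  · exact ⟨ρ, hgcd, key ρ hgcd hρz h⟩
  · exfalso
    have : pairingMap ρ = 0 := by
      refine LinearMap.ext_on hspan ?_
      rintro _ (rfl | hy)
      · simp [h]
      · simp [hρz _ (Submodule.subset_span hy)]
    rw [pairingMap_eq_zero this] at hgcd
    have : Finset.univ.gcd (0 : Fin n → ℤ) = 0 := Finset.gcd_eq_zero_iff.2 (by simp)
    omega
  · have hgcd' : Finset.univ.gcd (-ρ) = 1 := by
      refine Eq.trans ?_ hgcd
      exact dvd_antisymm_of_normalize_eq Finset.normalize_gcd Finset.normalize_gcd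
        (Finset.dvd_gcd fun i hi => (Int.dvd_neg).1 (Finset.gcd_dvd (f := -ρ) hi))
        (Finset.dvd_gcd fun i hi => (Int.dvd_neg).2 (Finset.gcd_dvd hi))
    exact ⟨-ρ, hgcd', key _ hgcd' (fun y hy => by simp [neg_pairing, hρz y hy])
      (by simpa [neg_pairing] using h)⟩

/-- A supporting hyperplane of `P` is that of a facet if the directions from a point `m` of the
face to other points of it span a space of codimension at most one. -/
theorem isFacet_of_span {n : ℕ} {P : Set (Fin n → ℝ)} {ρ : Fin n → ℤ} {m x : Fin n → ℝ}
    (hρ : Finset.univ.gcd ρ = 1) (hm : m ∈ P) (hle : ∀ y ∈ P, pairing ρ m ≤ pairing ρ y)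
    (S : Set (Fin n → ℝ)) (hS : ∀ d ∈ S, m + d ∈ P ∧ pairing ρ d = 0)
    (hspan : Submodule.span ℝ (insert x S) = ⊤) : IsFacet P ρ (pairing ρ m) := by
  refine ⟨hρ, hle, ⟨m, hm, rfl⟩, ?_⟩
  set F := {y ∈ P | pairing ρ y = pairing ρ m}
  have h1 : Submodule.span ℝ S ≤ vectorSpan ℝ F := by
    rw [Submodule.span_le]
    intro d hd
    have : m + d ∈ F := ⟨(hS d hd).1, by rw [pairing_add, (hS d hd).2, add_zero]⟩
    simpa using vsub_mem_vectorSpan ℝ this (⟨hm, rfl⟩ : m ∈ F)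
  have h2 : vectorSpan ℝ F ≤ LinearMap.ker (pairingMap ρ) := by
    rw [vectorSpan_def, Submodule.span_le]
    rintro _ ⟨y, hy, y', hy', rfl⟩
    simp [pairing_sub, hy.2, hy'.2]
  have h3 : vectorSpan ℝ F ≠ ⊤ := by
    intro h
    rw [h, top_le_iff, LinearMap.ker_eq_top] at h2
    rw [pairingMap_eq_zero h2] at hρ
    have : Finset.univ.gcd (0 : Fin n → ℤ) = 0 := Finset.gcd_eq_zero_iff.2 (by simp)
    omega
  have h4 := Submodule.finrank_lt h3
  have h5 : n ≤ Module.finrank ℝ (Submodule.span ℝ S) + 1 := by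
    have e1 : Module.finrank ℝ (Submodule.span ℝ (insert x S)) = n := by
      rw [hspan, finrank_top, Module.finrank_fin_fun]
    rw [Submodule.span_insert] at e1
    have e2 := Submodule.finrank_add_le_finrank_add_finrank (Submodule.span ℝ {x})
      (Submodule.span ℝ S)
    have e3 : Module.finrank ℝ (Submodule.span ℝ {x}) ≤ 1 := by
      simpa using finrank_span_le_card (R := ℝ) {x}
    omega
  have h6 := Submodule.finrank_mono h1
  rw [Module.finrank_fin_fun] at h4
  omega

/-! ### Dual lattice bases -/

section DualBasis

variable {n : ℕ}

/-- The entries of `u j` are the `j`-th `b`-coordinates of the standard vectors, so pairing with `u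
j` reads off the `j`-th `b`-coordinate. -/
theorem exists_dual_vectors (b : Module.Basis (Fin n) ℤ (Fin n → ℤ)) :
    ∃ u : Fin n → Fin n → ℤ, ∀ i j, b i ⬝ᵥ u j = if i = j then 1 else 0 := by
  refine ⟨b.toMatrix (Pi.basisFun ℤ (Fin n)), fun i j => ?_⟩
  have h := congrFun (congrFun
    (Module.Basis.toMatrix_mul_toMatrix_flip b (Pi.basisFun ℤ (Fin n))) j) i
  rw [Matrix.mul_apply, Matrix.one_apply] at h
  rw [dotProduct_comm, dotProduct]
  simp only [eq_comm (a := i), ← h, Module.Basis.toMatrix_apply, Pi.basisFun_repr]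

theorem sum_dotProduct_smul_basis (b : Module.Basis (Fin n) ℤ (Fin n → ℤ))
    {u : Fin n → Fin n → ℤ} (hu : ∀ i j, b i ⬝ᵥ u j = if i = j then 1 else 0)
    (ρ : Fin n → ℤ) : ∑ j, (ρ ⬝ᵥ u j) • b j = ρ := by
  conv_rhs => rw [← b.sum_repr ρ]
  refine Finset.sum_congr rfl fun j _ => ?_
  congr 1
  conv_lhs => rw [← b.sum_repr ρ]
  simp only [sum_dotProduct, smul_dotProduct, hu, smul_eq_mul, mul_ite, mul_one, mul_zero,
    Finset.sum_ite_eq', Finset.mem_univ, if_true]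

theorem eq_of_pairing_basis_eq (b : Module.Basis (Fin n) ℤ (Fin n → ℤ)) {x y : Fin n → ℝ}
    (h : ∀ i, pairing (b i) x = pairing (b i) y) : x = y := by
  have key : ∀ (ρ : Fin n → ℤ), pairing ρ x = pairing ρ y := fun ρ => by
    rw [← b.sum_repr ρ, sum_smul_pairing, sum_smul_pairing]
    simp only [h]
  ext k
  have := key (Pi.single k 1)
  simpa [pairing, Pi.single_apply] using this

theorem pairing_dual {b u : Fin n → Fin n → ℤ}
    (hu : ∀ i j, b i ⬝ᵥ u j = if i = j then 1 else 0) (i j : Fin n) :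
    pairing (b i) (toReal (u j)) = if i = j then 1 else 0 := by
  rw [pairing_toReal, hu]; split_ifs <;> simp

end DualBasis

/-! ### Edge vectors at a smooth vertex -/

section Hull

variable {n : ℕ}

theorem le_pairing_of_hull {V : Finset (Fin n → ℤ)} {ρ : Fin n → ℤ} {c : ℝ}
    (h : ∀ v ∈ V, c ≤ pairing ρ (toReal v)) :
    ∀ y ∈ convexHull ℝ (toReal '' (V : Set (Fin n → ℤ))), c ≤ pairing ρ y := by
  have : convexHull ℝ (toReal '' (V : Set (Fin n → ℤ))) ⊆ {y | c ≤ pairingMap ρ y} :=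
    convexHull_min (by rintro _ ⟨v, hv, rfl⟩; exact h v hv)
      (convex_halfSpace_ge (pairingMap ρ).isLinear c)
  exact fun y hy => this hy

theorem lt_pairing_of_hull {V : Finset (Fin n → ℤ)} {ρ : Fin n → ℤ} {c : ℝ}
    (h : ∀ v ∈ V, c < pairing ρ (toReal v)) :
    ∀ y ∈ convexHull ℝ (toReal '' (V : Set (Fin n → ℤ))), c < pairing ρ y := by
  have : convexHull ℝ (toReal '' (V : Set (Fin n → ℤ))) ⊆ {y | c < pairingMap ρ y} :=
    convexHull_min (by rintro _ ⟨v, hv, rfl⟩; exact h v hv)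
      (convex_halfSpace_gt (pairingMap ρ).isLinear c)
  exact fun y hy => this hy

/-- Otherwise every lattice generator would satisfy the inequality strictly, hence so would the
whole hull, and the face would be empty. -/
theorem IsFacet.exists_int {P : Set (Fin n → ℝ)} (hP : IsFullDimLatticePolytope P)
    {ρ : Fin n → ℤ} {c : ℝ} (h : IsFacet P ρ c) : ∃ k : ℤ, c = k := by
  obtain ⟨V, rfl⟩ := hP.eq_hull
  obtain ⟨y, hy, hyc⟩ := h.face_nonempty
  by_contra! hc
  refine (lt_pairing_of_hull (c := c) (fun v hv => ?_) y hy).ne' hyc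
  refine lt_of_le_of_ne (h.le_pairing _ (subset_convexHull ℝ _ ⟨v, hv, rfl⟩)) ?_
  rw [pairing_toReal]
  exact hc _

theorem exists_toReal_eq_of_mem_extremePoints {P : Set (Fin n → ℝ)}
    (hP : IsFullDimLatticePolytope P) {m : Fin n → ℝ} (hm : m ∈ Set.extremePoints ℝ P) :
    ∃ z, toReal z = m := by
  obtain ⟨V, rfl⟩ := hP.eq_hull
  obtain ⟨z, -, hz⟩ := extremePoints_convexHull_subset hm
  exact ⟨z, hz⟩

/-- If the ray from a vertex `m` in direction `x` meets the hull of `V` only in `m`, then some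
functional attains its minimum over `V` at `m` and is negative at `x`. -/
theorem exists_dual_neg_of_ray {V : Finset (Fin n → ℤ)} {m x : Fin n → ℝ}
    (hm : m ∈ Set.extremePoints ℝ (convexHull ℝ (toReal '' (V : Set (Fin n → ℤ)))))
    (hray : ∀ t : ℝ, 0 < t → m + t • x ∉ convexHull ℝ (toReal '' (V : Set (Fin n → ℤ))))
    (s : Module.Dual ℝ (Fin n → ℝ)) (hs : 0 < s x) :
    ∃ f : Module.Dual ℝ (Fin n → ℝ), (∀ v ∈ V, 0 ≤ f (toReal v - m)) ∧ f x < 0 := by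
  set P := convexHull ℝ (toReal '' (V : Set (Fin n → ℤ)))
  -- Since `m` is extreme, the hull of the other generators misses `m`; by assumption it also misses
  -- the rest of the ray, so the two can be separated strictly.
  set T := toReal '' (V : Set (Fin n → ℤ)) \ {m}
  have hTfin : T.Finite := (V.finite_toSet.image _).subset Set.sdiff_subset
  have hK : convexHull ℝ T ⊆ P \ {m} := by
    refine convexHull_min ?_
      (((convex_convexHull ℝ _).mem_extremePoints_iff_convex_sdiff.1 hm).2)
    exact fun y hy => ⟨subset_convexHull ℝ _ hy.1, hy.2⟩
  set R := (fun t : ℝ => m + t • x) '' Set.Ici 0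
  have hRclosed : IsClosed R := by
    have : R = (fun y => m + y) '' ((fun t : ℝ => t • x) '' Set.Ici 0) := by
      rw [Set.image_image]
    rw [this]
    exact (Homeomorph.addLeft m).isClosedMap _ (isClosedMap_smul_left x _ isClosed_Ici)
  have hRconvex : Convex ℝ R := by
    have : R = (fun y => m + y) '' ((LinearMap.toSpanSingleton ℝ _ x) '' Set.Ici 0) := by
      rw [Set.image_image]; rfl
    rw [this]
    exact ((convex_Ici (0 : ℝ)).linear_image _).translate m
  have hdisj : Disjoint (convexHull ℝ T) R := by
    rw [Set.disjoint_left]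
    rintro y hy ⟨t, ht, rfl⟩
    rcases (Set.mem_Ici.1 ht).eq_or_lt with h | h
    · exact (hK hy).2 (by simp [← h])
    · exact hray t h (hK hy).1
  obtain ⟨f, a, c, hfa, hac, hfc⟩ := geometric_hahn_banach_compact_closed
    (convex_convexHull ℝ T) (hTfin.isCompact_convexHull ℝ) hRconvex hRclosed hdisj
  have hcm : c < f m := hfc m ⟨0, by simp, by simp⟩
  have hfx : 0 ≤ f x := by
    by_contra! h
    have h1 := hfc (m + ((c - f m) / f x) • x)
      ⟨(c - f m) / f x, (div_pos_of_neg_of_neg (sub_neg.2 hcm) h).le, rfl⟩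
    have h2 : (c - f m) / f x * f x = c - f m := by
      have := h.ne
      field_simp
    rw [map_add, map_smul, smul_eq_mul, h2] at h1
    linarith
  -- Separation gives only `0 ≤ f x`. A small multiple of `s` makes the value at `x` strictly
  -- negative without spoiling the finitely many strict inequalities on `T`.
  have hev : ∀ᶠ ε in nhdsWithin (0 : ℝ) (Set.Ioi 0),
      ∀ y ∈ T, 0 < (f m - f y) - ε * s (y - m) := by
    rw [Filter.eventually_all_finite hTfin]
    intro y hy
    have h1 : 0 < f m - f y := by
      have := hfa y (subset_convexHull ℝ _ hy); linarith
    have h2 : Filter.Tendsto (fun ε : ℝ => (f m - f y) - ε * s (y - m))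
        (nhdsWithin 0 (Set.Ioi 0)) (nhds ((f m - f y) - 0 * s (y - m))) :=
      ((continuous_const.sub (continuous_id.mul continuous_const)).tendsto 0).mono_left
        nhdsWithin_le_nhds
    exact h2.eventually (lt_mem_nhds (by simpa using h1))
  obtain ⟨ε, hε, hε0⟩ := (hev.and self_mem_nhdsWithin).exists
  refine ⟨-(f : Module.Dual ℝ (Fin n → ℝ)) - ε • s, fun v hv => ?_, ?_⟩
  · by_cases h : toReal v = m
    · simp [h]
    · have := hε (toReal v) ⟨⟨v, hv, rfl⟩, h⟩
      simp only [map_sub, LinearMap.sub_apply, LinearMap.neg_apply, LinearMap.smul_apply,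
        smul_eq_mul, ContinuousLinearMap.coe_coe] at this ⊢
      linarith
  · have := mul_pos hε0 hs
    simp only [LinearMap.sub_apply, LinearMap.neg_apply, LinearMap.smul_apply,
        smul_eq_mul, ContinuousLinearMap.coe_coe]
    linarith

/-- If the ray from a vertex in an integral direction `x` meets `P` only in that vertex, then the
normal of some facet through the vertex is negative at `x`. -/
theorem exists_normal_neg_of_ray {P : Set (Fin n → ℝ)} (hP : IsFullDimLatticePolytope P)
    {m : Fin n → ℝ} (hm : m ∈ Set.extremePoints ℝ P) (x : Fin n → ℤ)
    (hray : ∀ t : ℝ, 0 < t → m + t • toReal x ∉ P) (hx : x ≠ 0) :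
    ∃ ρ ∈ normalsAt P m, pairing ρ (toReal x) < 0 := by
  classical
  obtain ⟨z, rfl⟩ := exists_toReal_eq_of_mem_extremePoints hP hm
  have hspans := hP.spans
  obtain ⟨V, rfl⟩ := hP.eq_hull
  set P := convexHull ℝ (toReal '' (V : Set (Fin n → ℤ)))
  have hzV : toReal z ∈ toReal '' (V : Set (Fin n → ℤ)) := extremePoints_convexHull_subset hm
  have hs : 0 < pairingMap x (toReal x) := by
    rw [pairingMap_apply, pairing_toReal]
    exact_mod_cast lt_of_le_of_ne (Finset.sum_nonneg fun i _ => mul_self_nonneg (x i))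
      fun h => hx (dotProduct_self_eq_zero.1 h.symm)
  obtain ⟨f, hfV, hfx⟩ := exists_dual_neg_of_ray hm hray _ hs
  let D : Finset (Fin n → ℝ) := V.image fun v => toReal v - toReal z
  have hD : Submodule.span ℝ (D : Set (Fin n → ℝ)) = ⊤ := by
    have h1 : vectorSpan ℝ (toReal '' (V : Set (Fin n → ℤ))) = ⊤ := by
      rw [← direction_affineSpan, ← affineSpan_convexHull, hspans, AffineSubspace.direction_top]
    rw [vectorSpan_eq_span_vsub_set_right ℝ hzV, Set.image_image] at h1
    simpa [D] using h1
  obtain ⟨g, hgD, hgx, hgspan⟩ := exists_dual_span_insert_zeros D hD (toReal x) f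
    (by simpa [D] using hfV) hfx
  let Z : Set (Fin n → ℤ) := {d | z + d ∈ V ∧ g (toReal d) = 0}
  have hZspan : Submodule.span ℝ (insert (toReal x) (toReal '' Z)) = ⊤ := by
    rw [← hgspan]
    congr 2
    ext d
    constructor
    · rintro ⟨d, ⟨hd, hgd⟩, rfl⟩
      exact ⟨Finset.mem_image.2 ⟨_, hd, by rw [toReal_add, add_sub_cancel_left]⟩, hgd⟩
    · rintro ⟨hd, hgd⟩
      obtain ⟨v, hv, rfl⟩ := Finset.mem_image.1 hd
      rw [← toReal_sub] at hgd ⊢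
      exact ⟨v - z, ⟨by simpa using hv, hgd⟩, rfl⟩
  obtain ⟨ρ, hρ, r, hr, hgρ⟩ := exists_primitive_of_span Z x g (fun d hd => hd.2) hgx hZspan
  refine ⟨ρ, isFacet_of_span hρ hm.1 (le_pairing_of_hull fun v hv => ?_) (toReal '' Z) ?_ hZspan,
    ?_⟩
  · have := hgD _ (Finset.mem_image_of_mem _ hv)
    rw [hgρ, pairing_sub] at this
    linarith [nonneg_of_mul_nonneg_right this hr]
  · rintro _ ⟨d, ⟨hd, hgd⟩, rfl⟩
    rw [hgρ] at hgd
    exact ⟨subset_convexHull ℝ _ ⟨_, hd, toReal_add _ _⟩, (mul_eq_zero.1 hgd).resolve_left hr.ne'⟩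
  · rw [hgρ] at hgx
    exact (pos_iff_neg_of_mul_neg hgx).1 hr

/-- At a vertex of a smooth lattice polytope, the primitive edge vectors, added to the vertex,
stay in the polytope. -/
theorem add_dual_mem {P : Set (Fin n → ℝ)} (hP : IsFullDimLatticePolytope P)
    {m : Fin n → ℝ} (hm : m ∈ Set.extremePoints ℝ P)
    (b : Module.Basis (Fin n) ℤ (Fin n → ℤ)) (hb : Set.range b = normalsAt P m)
    {u : Fin n → Fin n → ℤ} (hu : ∀ i j, b i ⬝ᵥ u j = if i = j then 1 else 0) (j : Fin n) :
    m + toReal (u j) ∈ P := by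
  classical
  have hbu := pairing_dual hu
  have hfacet : ∀ i, IsFacet P (b i) (pairing (b i) m) := fun i => by
    have : b i ∈ normalsAt P m := hb ▸ Set.mem_range_self i
    exact this
  -- If the ray left `P` at once, some normal through `m` would be negative at `u j`; but these
  -- normals are the `b i`, which pair with `u j` to 0 or 1.
  obtain ⟨t, ht, htP⟩ : ∃ t : ℝ, 0 < t ∧ m + t • toReal (u j) ∈ P := by
    by_contra! h
    have hne : u j ≠ 0 := fun h0 => by simpa [h0] using hu j j
    obtain ⟨ρ, hρ, hneg⟩ := exists_normal_neg_of_ray hP hm (u j) h hne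
    rw [← hb] at hρ
    obtain ⟨i, rfl⟩ := hρ
    rw [hbu] at hneg
    split_ifs at hneg <;> linarith
  obtain ⟨z, rfl⟩ := exists_toReal_eq_of_mem_extremePoints hP hm
  obtain ⟨V, hV⟩ := hP.eq_hull
  have hVP : ∀ v ∈ V, toReal v ∈ P := fun v hv => hV ▸ subset_convexHull ℝ _ ⟨v, hv, rfl⟩
  have hmem := htP
  rw [hV, ← Finset.coe_image, Finset.mem_convexHull'] at hmem
  obtain ⟨w, hw0, hw1, hw⟩ := hmem
  set W := V.image toReal
  have hWP : ∀ y ∈ W, y ∈ P := fun y hy => by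
    obtain ⟨v, hv, rfl⟩ := Finset.mem_image.1 hy; exact hVP v hv
  -- Write `m + t u_j` as a convex combination of generators. For `i ≠ j` the non-negative excesses
  -- over `m` sum to zero, so every generator of positive weight lies on the line `m + ℝ u_j`; one
  -- of them has positive `j`-th excess.
  have hsum : ∀ i, ∑ y ∈ W, w y * (pairing (b i) y - pairing (b i) (toReal z)) =
      t * if i = j then 1 else 0 := by
    intro i
    have := congrArg (pairing (b i)) hw
    simp only [pairing_sum, pairing_smul, pairing_add, hbu] at this
    simp only [mul_sub, Finset.sum_sub_distrib, ← Finset.sum_mul, hw1, this]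
    ring
  have hnonneg : ∀ i, ∀ y ∈ W, 0 ≤ w y * (pairing (b i) y - pairing (b i) (toReal z)) :=
    fun i y hy => mul_nonneg (hw0 y hy)
      (sub_nonneg.2 ((hfacet i).le_pairing y (hWP y hy)))
  obtain ⟨y, hy, hypos⟩ : ∃ y ∈ W, 0 < w y * (pairing (b j) y - pairing (b j) (toReal z)) := by
    by_contra! h
    have h1 := hsum j
    have h2 := Finset.sum_nonpos h
    simp only [if_true, mul_one] at h1
    linarith
  have hwy : w y ≠ 0 := fun h => by simp [h] at hypos
  obtain ⟨v, hv, rfl⟩ := Finset.mem_image.1 hy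
  have hother : ∀ i, i ≠ j → pairing (b i) (toReal v) = pairing (b i) (toReal z) := by
    intro i hij
    have h1 := hsum i
    rw [if_neg hij, mul_zero, Finset.sum_eq_zero_iff_of_nonneg (hnonneg i)] at h1
    linarith [(mul_eq_zero.1 (h1 _ hy)).resolve_left hwy]
  set k := b j ⬝ᵥ v - b j ⬝ᵥ z with hk
  have hkR : pairing (b j) (toReal v) - pairing (b j) (toReal z) = k := by
    rw [pairing_toReal, pairing_toReal, hk]; push_cast; ring
  have hkpos : (0 : ℝ) < k := by
    rw [← hkR]; exact pos_of_mul_pos_right hypos (hw0 _ hy)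
  have hk1 : (1 : ℝ) ≤ k := by
    have : 0 < k := by exact_mod_cast hkpos
    exact_mod_cast this
  have hconv : Convex ℝ P := hV ▸ convex_convexHull ℝ _
  -- That generator is `m + k u_j` with an integer `k ≥ 1`, so `m + u_j` lies on the segment from
  -- `m` to it.
  have hcomb := hconv hm.1 (hVP v hv) (a := 1 - 1 / k) (b := 1 / k)
    (by rw [sub_nonneg, div_le_one hkpos]; exact hk1) (by positivity) (by ring)
  convert hcomb using 1
  refine eq_of_pairing_basis_eq b fun i => ?_
  rw [pairing_add, pairing_add, pairing_smul, pairing_smul, hbu]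
  by_cases hij : i = j
  · subst hij
    rw [if_pos rfl, sub_eq_iff_eq_add'.1 hkR]
    field_simp
    ring
  · rw [if_neg hij, hother i hij]; ring

end Hull

/-! ### Facets and vertices of dilates -/

section Scaling

variable {n : ℕ} {P : Set (Fin n → ℝ)}

theorem IsFacet.smul {ρ : Fin n → ℤ} {c a : ℝ} (ha : 0 < a) (h : IsFacet P ρ c) :
    IsFacet (a • P) ρ (a * c) := by
  have hface : {x ∈ a • P | pairing ρ x = a * c} = a • {x ∈ P | pairing ρ x = c} := by
    ext x
    constructor
    · rintro ⟨⟨y, hy, rfl⟩, hx⟩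
      have hx' : a * pairing ρ y = a * c := by rw [← pairing_smul]; exact hx
      exact ⟨y, ⟨hy, mul_left_cancel₀ ha.ne' hx'⟩, rfl⟩
    · rintro ⟨y, ⟨hy, rfl⟩, rfl⟩
      exact ⟨⟨y, hy, rfl⟩, pairing_smul _ _ _⟩
  refine ⟨h.primitive, ?_, ?_, ?_⟩
  · rintro _ ⟨y, hy, rfl⟩
    have := mul_le_mul_of_nonneg_left (h.le_pairing y hy) ha.le
    rw [← pairing_smul] at this
    exact this
  · rw [hface]; exact h.face_nonempty.smul_set
  · rw [hface]
    let e : (Fin n → ℝ) ≃ₗ[ℝ] (Fin n → ℝ) := LinearEquiv.smulOfNeZero ℝ _ a ha.ne'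
    have := AffineMap.map_vectorSpan (e : (Fin n → ℝ) →ₗ[ℝ] (Fin n → ℝ)).toAffineMap
      (s := {x ∈ P | pairing ρ x = c})
    have h2 : (a • {x ∈ P | pairing ρ x = c}) =
      (e : (Fin n → ℝ) →ₗ[ℝ] (Fin n → ℝ)).toAffineMap '' {x ∈ P | pairing ρ x = c} := rfl
    rw [h2, ← this]
    exact (congrArg (· + 1) (LinearEquiv.finrank_map_eq e _)).trans h.face_dim

theorem isFacet_smul_iff {ρ : Fin n → ℤ} {c a : ℝ} (ha : 0 < a) :
    IsFacet (a • P) ρ (a * c) ↔ IsFacet P ρ c := by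
  refine ⟨fun h => ?_, IsFacet.smul ha⟩
  have := h.smul (inv_pos.2 ha)
  rwa [inv_smul_smul₀ ha.ne', inv_mul_cancel_left₀ ha.ne'] at this

theorem normalsAt_smul {a : ℝ} (ha : 0 < a) (m : Fin n → ℝ) :
    normalsAt (a • P) (a • m) = normalsAt P m := by
  ext ρ
  simp only [normalsAt, Set.mem_ofPred_eq, pairing_smul, isFacet_smul_iff ha]

theorem mem_shrink_smul {a : ℝ} (ha : 0 < a) {s : ℕ} {x : Fin n → ℝ} :
    x ∈ shrink (a • P) s ↔ ∀ ρ c, IsFacet P ρ c → a * c + s ≤ pairing ρ x := by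
  refine ⟨fun h ρ c hc => h ρ _ (hc.smul ha), fun h ρ c hc => ?_⟩
  have hc' : c = a * (a⁻¹ * c) := by rw [mul_inv_cancel_left₀ ha.ne']
  rw [hc'] at hc ⊢
  exact h ρ _ ((isFacet_smul_iff ha).1 hc)

theorem exists_smul_of_mem_extremePoints_smul {a : ℝ} (ha : 0 < a) {m : Fin n → ℝ}
    (hm : m ∈ Set.extremePoints ℝ (a • P)) : ∃ m' ∈ Set.extremePoints ℝ P, m = a • m' := by
  let e : (Fin n → ℝ) ≃ₗ[ℝ] (Fin n → ℝ) := LinearEquiv.smulOfNeZero ℝ _ a ha.ne'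
  have h : a • P = e '' P := rfl
  rw [h, ← image_extremePoints] at hm
  obtain ⟨m', hm', rfl⟩ := hm
  exact ⟨m', hm', rfl⟩

theorem IsFullDimLatticePolytope.extremePoints_nonempty (hP : IsFullDimLatticePolytope P) :
    (Set.extremePoints ℝ P).Nonempty := by
  have hne : P.Nonempty := by
    rw [← affineSpan_nonempty ℝ, hP.spans]
    exact Set.univ_nonempty
  obtain ⟨V, rfl⟩ := hP.eq_hull
  exact ((V.finite_toSet.image _).isCompact_convexHull ℝ).extremePoints_nonempty hne

end Scaling

/-! ### Shifted vertices and facet heights -/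

section Vertex

variable {n : ℕ} {P : Set (Fin n → ℝ)}

/-- Smooth coordinates at a vertex `m`: a lattice basis `b` of facet normals, and the dual basis
`u` of primitive edge vectors. -/
theorem IsSmooth.exists_coordinates (hP : IsFullDimLatticePolytope P) (hs : IsSmooth P)
    {m : Fin n → ℝ} (hm : m ∈ Set.extremePoints ℝ P) :
    ∃ (b : Module.Basis (Fin n) ℤ (Fin n → ℤ)) (u : Fin n → Fin n → ℤ),
      Set.range b = normalsAt P m ∧ (∀ i j, b i ⬝ᵥ u j = if i = j then 1 else 0) ∧
      ∀ j, m + toReal (u j) ∈ P := by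
  obtain ⟨b, hb⟩ := hs m hm
  obtain ⟨u, hu⟩ := exists_dual_vectors b
  exact ⟨b, u, hb, hu, add_dual_mem hP hm b hb hu⟩

/-- The lattice distance `h` of a vertex from a facet, and bounds for the pairings of the facet
normal with the primitive edge vectors. -/
theorem IsFacet.exists_height (hP : IsFullDimLatticePolytope P) {m : Fin n → ℝ}
    (hm : m ∈ Set.extremePoints ℝ P) {b : Module.Basis (Fin n) ℤ (Fin n → ℤ)}
    {u : Fin n → Fin n → ℤ} (hb : Set.range b = normalsAt P m)
    (hu : ∀ i j, b i ⬝ᵥ u j = if i = j then 1 else 0) (hmu : ∀ j, m + toReal (u j) ∈ P)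
    {ρ : Fin n → ℤ} {c : ℝ} (h : IsFacet P ρ c) :
    ∃ k : ℤ, pairing ρ m - c = k ∧ 0 ≤ k ∧ (∀ j, -k ≤ ρ ⬝ᵥ u j) ∧
      (k = 0 → ∑ j, ρ ⬝ᵥ u j = 1) := by
  obtain ⟨z, rfl⟩ := exists_toReal_eq_of_mem_extremePoints hP hm
  obtain ⟨c, rfl⟩ := h.exists_int hP
  refine ⟨ρ ⬝ᵥ z - c, by rw [pairing_toReal]; push_cast; ring, ?_, fun j => ?_, fun h0 => ?_⟩
  · have := h.le_pairing _ hm.1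
    rw [pairing_toReal] at this
    exact sub_nonneg.2 (by exact_mod_cast this)
  · have := h.le_pairing _ (hmu j)
    rw [pairing_add, pairing_toReal, pairing_toReal] at this
    have : c ≤ ρ ⬝ᵥ z + ρ ⬝ᵥ u j := by exact_mod_cast this
    linarith
  · have hmem : ρ ∈ normalsAt P (toReal z) := by
      rw [← sub_eq_zero.1 h0, ← pairing_toReal] at h
      exact h
    rw [← hb] at hmem
    obtain ⟨i, rfl⟩ := hmem
    simp [hu]

/-- The `k`-th dilate is `1`-spanned if at every vertex the shifted vertex satisfies the shifted
facet inequalities. -/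
theorem isSpanned_smul_one (hP : IsFullDimLatticePolytope P) (hs : IsSmooth P) {k : ℕ}
    (hk : 0 < k)
    (H : ∀ m ∈ Set.extremePoints ℝ P, ∀ (b : Module.Basis (Fin n) ℤ (Fin n → ℤ))
      (u : Fin n → Fin n → ℤ), Set.range b = normalsAt P m →
      (∀ i j, b i ⬝ᵥ u j = if i = j then 1 else 0) → (∀ j, m + toReal (u j) ∈ P) →
      ∀ ρ c, IsFacet P ρ c → k * c + 1 ≤ k * pairing ρ m + ((∑ j, ρ ⬝ᵥ u j : ℤ) : ℝ)) :
    IsSpanned ((k : ℝ) • P) 1 := by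
  have hk' : (0 : ℝ) < k := by exact_mod_cast hk
  intro m' hm'
  obtain ⟨m, hm, rfl⟩ := exists_smul_of_mem_extremePoints_smul hk' hm'
  obtain ⟨b, u, hb, hu, hmu⟩ := hs.exists_coordinates hP hm
  have hpair : ∀ ρ : Fin n → ℤ, pairing ρ ((k : ℝ) • m + toReal (∑ j, u j)) =
      k * pairing ρ m + ((∑ j, ρ ⬝ᵥ u j : ℤ) : ℝ) := fun ρ => by
    rw [pairing_add, pairing_smul, pairing_toReal, dotProduct_sum]
  -- Each `b i` pairs to 1 with `∑ u_j`, so adding this sum moves every facet through the vertex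
  -- inwards by exactly 1.
  refine ⟨(k : ℝ) • m + toReal (∑ j, u j), (mem_shrink_smul hk').2 fun ρ c hc => ?_, fun ρ hρ => ?_⟩
  · rw [hpair]
    exact_mod_cast H m hm b u hb hu hmu ρ c hc
  · rw [normalsAt_smul hk', ← hb] at hρ
    obtain ⟨i, rfl⟩ := hρ
    rw [hpair, pairing_smul]
    simp [hu]

/-- For a facet at height `k > 0`, the `n` edge vectors lose at most `n k` of the available `(n + 1)
k`, which leaves `k ≥ 1`. -/
theorem isSpanned_smul_succ (hP : IsFullDimLatticePolytope P) (hs : IsSmooth P) :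
    IsSpanned (((n + 1 : ℕ) : ℝ) • P) 1 := by
  refine isSpanned_smul_one hP hs n.succ_pos fun m hm b u hb hu hmu ρ c hc => ?_
  obtain ⟨k, hk, hk0, hku, hsum⟩ := hc.exists_height hP hm hb hu hmu
  have key : 1 ≤ (n + 1) * k + ∑ j, ρ ⬝ᵥ u j := by
    rcases hk0.eq_or_lt with h | h
    · rw [hsum h.symm, ← h]; simp
    · have := Finset.sum_le_sum fun j (_ : j ∈ Finset.univ) => hku j
      simp only [Finset.sum_const, Finset.card_univ, Fintype.card_fin, nsmul_eq_mul] at this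
      linarith
  have key' : (1 : ℝ) ≤ (n + 1) * k + ((∑ j, ρ ⬝ᵥ u j : ℤ) : ℝ) := by exact_mod_cast key
  rw [← hk] at key'
  push_cast at key' ⊢
  linarith

end Vertex

/-! ### The unit simplex and the equality case -/

section Simplex

variable {n : ℕ} {P : Set (Fin n → ℝ)}

theorem mem_unitSimplex {x : Fin n → ℝ} :
    x ∈ unitSimplex n ↔ (∀ i, 0 ≤ x i) ∧ ∑ i, x i ≤ 1 := by
  constructor
  · have hconv : Convex ℝ {x : Fin n → ℝ | (∀ i, 0 ≤ x i) ∧ ∑ i, x i ≤ 1} := by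
      intro x hx y hy a b ha hb hab
      refine ⟨fun i => add_nonneg (mul_nonneg ha (hx.1 i)) (mul_nonneg hb (hy.1 i)), ?_⟩
      simp only [Pi.add_apply, Pi.smul_apply, smul_eq_mul, Finset.sum_add_distrib,
        ← Finset.mul_sum]
      have h1 := mul_le_mul_of_nonneg_left hx.2 ha
      have h2 := mul_le_mul_of_nonneg_left hy.2 hb
      linarith
    refine fun hx => convexHull_min ?_ hconv hx
    rintro _ (rfl | ⟨i, rfl⟩)
    · simp
    · exact ⟨fun j => (Pi.single_nonneg.2 zero_le_one : (0 : Fin n → ℝ) ≤ Pi.single i 1) j, by simp⟩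
  · rintro ⟨h0, h1⟩
    have hc : Convex ℝ (unitSimplex n) := convex_convexHull ℝ _
    have h := hc.sum_mem (t := Finset.univ)
      (w := fun o : Option (Fin n) => o.elim (1 - ∑ i, x i) x)
      (z := fun o => o.elim 0 fun i => Pi.single i 1)
      (by rintro (_ | i) -; exacts [sub_nonneg.2 h1, h0 i])
      (by simp [Fintype.sum_option])
      (by
        rintro (_ | i) -
        · exact subset_convexHull ℝ _ (Set.mem_insert _ _)
        · exact subset_convexHull ℝ _ (Set.mem_insert_of_mem _ ⟨i, rfl⟩))
    convert h using 1
    ext j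
    simp [Fintype.sum_option, Finset.sum_apply, Pi.single_apply]

theorem mulVec_map_add_apply (U : Matrix (Fin n) (Fin n) ℤ) (t : Fin n → ℤ) (x : Fin n → ℝ)
    (i : Fin n) :
    (Matrix.mulVec (U.map fun z => (z : ℝ)) x + toReal t) i = pairing (U i) x + t i := rfl

/-- A polytope cut out in smooth coordinates at a vertex by the inequalities of the unit simplex
is lattice equivalent to it. -/
theorem latticeEquivalent_unitSimplex (hP : IsFullDimLatticePolytope P) {m : Fin n → ℝ}
    (hm : m ∈ Set.extremePoints ℝ P) {b : Module.Basis (Fin n) ℤ (Fin n → ℤ)}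
    {u : Fin n → Fin n → ℤ} (hu : ∀ i j, b i ⬝ᵥ u j = if i = j then 1 else 0)
    (hmu : ∀ j, m + toReal (u j) ∈ P) (hnonneg : ∀ y ∈ P, ∀ i, pairing (b i) m ≤ pairing (b i) y)
    (hle : ∀ y ∈ P, ∑ i, pairing (b i) y ≤ ∑ i, pairing (b i) m + 1) :
    LatticeEquivalent P (unitSimplex n) := by
  have hmP := hm.1
  have hconv : Convex ℝ P := by
    obtain ⟨V, rfl⟩ := hP.eq_hull
    exact convex_convexHull ℝ _
  obtain ⟨z, rfl⟩ := exists_toReal_eq_of_mem_extremePoints hP hm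
  let B : Matrix (Fin n) (Fin n) ℤ := Matrix.of b
  let C : Matrix (Fin n) (Fin n) ℤ := (Matrix.of u).transpose
  have hBC : B * C = 1 := by
    ext i j
    rw [Matrix.one_apply, ← hu i j]
    rfl
  refine ⟨⟨B, C, hBC, mul_eq_one_comm.1 hBC⟩, fun i => -(b i ⬝ᵥ z), ?_⟩
  have hφ : ∀ x i, (Matrix.mulVec (B.map fun z => (z : ℝ)) x + toReal fun i => -(b i ⬝ᵥ z)) i =
      pairing (b i) x - pairing (b i) (toReal z) := fun x i => by
    rw [mulVec_map_add_apply, pairing_toReal]; push_cast; rfl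
  refine Set.Subset.antisymm ?_ ?_
  · rintro _ ⟨y, hy, rfl⟩
    refine mem_unitSimplex.2 ⟨fun i => ?_, ?_⟩
    · exact (sub_nonneg.2 (hnonneg y hy i)).trans_eq (hφ y i).symm
    · refine (Finset.sum_congr rfl fun i _ => hφ y i).trans_le ?_
      rw [Finset.sum_sub_distrib]
      linarith [hle y hy]
  · refine convexHull_min ?_ ?_
    · rintro _ (rfl | ⟨j, rfl⟩)
      · exact ⟨toReal z, hmP, funext fun i => (hφ _ i).trans (sub_self _)⟩
      · refine ⟨_, hmu j, funext fun i => (hφ _ i).trans ?_⟩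
        rw [pairing_add, add_sub_cancel_left, pairing_dual hu]
        exact (Pi.single_apply j 1 i).symm
    · have := (hconv.linear_image (Matrix.mulVecLin (B.map fun z => (z : ℝ)))).translate
        (toReal fun i => -(b i ⬝ᵥ z))
      rw [Set.image_image] at this
      simpa only [add_comm, Matrix.mulVecLin_apply] using this

/-- The estimate with factor `n` is tight only when all edge vectors drop by the full height of one
facet, and this configuration forces the simplex. -/
theorem isSpanned_smul_dim (hP : IsFullDimLatticePolytope P) (hs : IsSmooth P) (hn : 0 < n)
    (hne : ¬ LatticeEquivalent P (unitSimplex n)) : IsSpanned ((n : ℝ) • P) 1 := by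
  refine isSpanned_smul_one hP hs hn fun m hm b u hb hu hmu ρ c hc => ?_
  obtain ⟨k, hk, hk0, hku, hsum⟩ := hc.exists_height hP hm hb hu hmu
  suffices key : 1 ≤ n * k + ∑ j, ρ ⬝ᵥ u j by
    have key' : (1 : ℝ) ≤ n * k + ((∑ j, ρ ⬝ᵥ u j : ℤ) : ℝ) := by exact_mod_cast key
    rw [← hk] at key'
    linarith
  by_contra! hlt
  -- A sum of non-negative integers that is less than 1, so every term vanishes.
  have hz : ∑ j, (ρ ⬝ᵥ u j + k) = 0 := by
    refine le_antisymm ?_ (Finset.sum_nonneg fun j _ => by linarith [hku j])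
    simp only [Finset.sum_add_distrib, Finset.sum_const, Finset.card_univ, Fintype.card_fin,
      nsmul_eq_mul]
    linarith
  rw [Finset.sum_eq_zero_iff_of_nonneg fun j _ => by linarith [hku j]] at hz
  have hρu : ∀ j, ρ ⬝ᵥ u j = -k := fun j => by linarith [hz j (Finset.mem_univ j)]
  have hρ : ρ = -k • ∑ j, b j := by
    rw [← sum_dotProduct_smul_basis b hu ρ, Finset.smul_sum]
    simp only [hρu]
  -- `ρ` is divisible by `k` and primitive; this also excludes `k = 0`.
  have hk1 : k = 1 := by
    have h1 : k ∣ Finset.univ.gcd ρ := Finset.dvd_gcd fun i _ => by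
      rw [hρ]; simp
    rw [hc.primitive] at h1
    exact Int.eq_one_of_dvd_one hk0 h1
  subst hk1
  have hρy : ∀ y, pairing ρ y = -∑ i, pairing (b i) y := fun y => by
    rw [← sum_dotProduct_smul_basis b hu ρ, sum_smul_pairing]
    simp [hρu]
  refine hne (latticeEquivalent_unitSimplex hP hm hu hmu (fun y hy i => ?_) fun y hy => ?_)
  · have : b i ∈ normalsAt P m := hb ▸ Set.mem_range_self i
    exact IsFacet.le_pairing this y hy
  · have := hc.le_pairing y hy
    rw [hρy] at hk this
    push_cast at hk
    linarith

/-- A lattice polytope equivalent to the unit simplex has `n + 1` facets, whose primitive normals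
sum up to zero. -/
theorem LatticeEquivalent.exists_facets (h : LatticeEquivalent P (unitSimplex n)) (hn : 0 < n) :
    ∃ (ρ : Fin n → Fin n → ℤ) (t : Fin n → ℤ), (∀ i, IsFacet P (ρ i) (-(t i : ℝ))) ∧
      IsFacet P (∑ i, (-1 : ℤ) • ρ i) (∑ i, (t i : ℝ) - 1) := by
  obtain ⟨U, t, hUt⟩ := h
  set ρ : Fin n → Fin n → ℤ := (U : Matrix (Fin n) (Fin n) ℤ) with hρ
  have hpre : ∀ y ∈ unitSimplex n, ∃ x ∈ P, ∀ i, pairing (ρ i) x + t i = y i := by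
    rintro y hy
    rw [← hUt] at hy
    obtain ⟨x, hx, rfl⟩ := hy
    exact ⟨x, hx, fun i => rfl⟩
  have himg : ∀ x ∈ P, (∀ i, 0 ≤ pairing (ρ i) x + t i) ∧ ∑ i, (pairing (ρ i) x + t i) ≤ 1 := by
    intro x hx
    have := Set.mem_image_of_mem
      (fun x => Matrix.mulVec ((U : Matrix (Fin n) (Fin n) ℤ).map fun z => (z : ℝ)) x + toReal t) hx
    rw [hUt] at this
    exact mem_unitSimplex.1 this
  have hinj : ∀ x y, (∀ i, pairing (ρ i) x = pairing (ρ i) y) → x = y := by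
    intro x y hxy
    ext k
    have hk : ∑ i, ((U⁻¹ : Matrix.GeneralLinearGroup (Fin n) ℤ) : Matrix (Fin n) (Fin n) ℤ) k i •
        ρ i = Pi.single k 1 := by
      ext l
      have := congrFun (congrFun (U.inv_mul) k) l
      rw [Matrix.mul_apply, Matrix.one_apply] at this
      simpa [Finset.sum_apply, Pi.single_apply, eq_comm] using this
    have h1 := sum_smul_pairing Finset.univ
      (((U⁻¹ : Matrix.GeneralLinearGroup (Fin n) ℤ) : Matrix (Fin n) (Fin n) ℤ) k) ρ x
    have h2 := sum_smul_pairing Finset.univ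
      (((U⁻¹ : Matrix.GeneralLinearGroup (Fin n) ℤ) : Matrix (Fin n) (Fin n) ℤ) k) ρ y
    simp only [hxy] at h1
    rw [← h2, hk] at h1
    simpa [pairing, Pi.single_apply] using h1
  -- The columns of `U⁻¹` are dual to the rows `ρ i` of `U`; they are the edge vectors at the
  -- preimage `p` of the origin.
  let v : Fin n → Fin n → ℤ := fun j k =>
    ((U⁻¹ : Matrix.GeneralLinearGroup (Fin n) ℤ) : Matrix (Fin n) (Fin n) ℤ) k j
  have hv : ∀ i j, ρ i ⬝ᵥ v j = if i = j then 1 else 0 := fun i j => by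
    have := congrFun (congrFun (U.mul_inv) i) j
    rw [Matrix.mul_apply, Matrix.one_apply] at this
    exact this
  have hw := pairing_dual hv
  obtain ⟨p, hp, hpt⟩ := hpre 0 (mem_unitSimplex.2 (by simp))
  have hpw : ∀ j, p + toReal (v j) ∈ P := by
    intro j
    obtain ⟨x, hx, hxt⟩ := hpre (Pi.single j 1)
      (subset_convexHull ℝ _ (Set.mem_insert_of_mem _ ⟨j, rfl⟩))
    convert hx using 1
    refine hinj _ _ fun i => ?_
    have h1 := hpt i
    have h2 := hxt i
    rw [Pi.single_apply] at h2
    rw [pairing_add, hw]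
    simp only [Pi.zero_apply] at h1
    linarith
  have hspan : ∀ S : Submodule ℝ (Fin n → ℝ), (∀ j, toReal (v j) ∈ S) → S = ⊤ := by
    intro S hS
    rw [eq_top_iff]
    intro x _
    have : x = ∑ j, pairing (ρ j) x • toReal (v j) := hinj _ _ fun i => by
      simp [pairing_sum, pairing_smul, hw]
    rw [this]
    exact S.sum_mem fun j _ => S.smul_mem _ (hS j)
  refine ⟨ρ, t, fun i => ?_, ?_⟩
  · have hpi : -(t i : ℝ) = pairing (ρ i) p := by
      have := hpt i
      simp only [Pi.zero_apply] at this
      linarith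
    rw [hpi]
    refine isFacet_of_span (x := toReal (v i)) (gcd_eq_one_of_dotProduct ((hv i i).trans (if_pos rfl)))
      hp (fun y hy => by rw [← hpi]; linarith [(himg y hy).1 i])
      ((fun j => toReal (v j)) '' {j | j ≠ i}) ?_ ?_
    · rintro _ ⟨j, hj, rfl⟩
      exact ⟨hpw j, (hw i j).trans (if_neg (Ne.symm hj))⟩
    · refine hspan _ fun j => Submodule.subset_span ?_
      by_cases hj : j = i
      · exact Or.inl (by rw [hj])
      · exact Or.inr ⟨j, hj, rfl⟩
  · have hσ : ∀ x, pairing (∑ i, (-1 : ℤ) • ρ i) x = -∑ i, pairing (ρ i) x := fun x => by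
      rw [sum_smul_pairing]; simp
    have hσw : ∀ j, pairing (∑ i, (-1 : ℤ) • ρ i) (toReal (v j)) = -1 := fun j => by
      rw [hσ]; simp [hw]
    -- The facet opposite `p` needs a base vertex, which exists because `n > 0`.
    let j₀ : Fin n := ⟨0, hn⟩
    have hpi : ∑ i, (t i : ℝ) - 1 =
        pairing (∑ i, (-1 : ℤ) • ρ i) (p + toReal (v j₀)) := by
      have : ∑ i, (pairing (ρ i) p + t i) = 0 := Finset.sum_eq_zero fun i _ => hpt i
      rw [Finset.sum_add_distrib] at this
      rw [pairing_add, hσw, hσ]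
      linarith
    rw [hpi]
    refine isFacet_of_span (x := toReal (v j₀)) ?_ (hpw j₀) (fun y hy => ?_)
      (Set.range fun j => toReal (v j) - toReal (v j₀)) ?_ ?_
    · refine gcd_eq_one_of_dotProduct (u := -v j₀) ?_
      simp [sum_dotProduct, hv]
    · have := (himg y hy).2
      rw [Finset.sum_add_distrib] at this
      rw [← hpi, hσ]
      linarith
    · rintro _ ⟨j, rfl⟩
      exact ⟨by simpa using hpw j, by rw [pairing_sub, hσw, hσw, sub_self]⟩
    · refine hspan _ fun j => ?_
      rw [← sub_add_cancel (toReal (v j)) (toReal (v j₀))]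
      exact Submodule.add_mem _ (Submodule.subset_span (Set.mem_insert_of_mem _ ⟨j, rfl⟩))
        (Submodule.subset_span (Set.mem_insert _ _))

/-- Summing all `n + 1` shifted inequalities at one point cancels the pairings and the `t i`,
leaving `-a + (n + 1) b ≤ 0`. -/
theorem LatticeEquivalent.le_of_mem_codegQSet (h : LatticeEquivalent P (unitSimplex n))
    (hn : 0 < n) {q : ℝ} (hq : q ∈ codegQSet P) : (n : ℝ) + 1 ≤ q := by
  obtain ⟨a, b, ha, hb, ⟨x, hx⟩, rfl⟩ := hq
  obtain ⟨ρ, t, hρ, hσ⟩ := h.exists_facets hn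
  rw [mem_shrink_smul (by exact_mod_cast ha)] at hx
  have h1 := Finset.sum_le_sum fun i (_ : i ∈ Finset.univ) => hx _ _ (hρ i)
  have h2 := hx _ _ hσ
  rw [sum_smul_pairing] at h2
  simp only [Finset.sum_add_distrib, Finset.sum_const, Finset.card_univ, Fintype.card_fin,
    nsmul_eq_mul, mul_neg, Finset.sum_neg_distrib, ← Finset.mul_sum, Int.cast_neg,
    Int.cast_one, neg_mul, one_mul] at h1 h2
  rw [le_div_iff₀ (by exact_mod_cast hb)]
  linarith

end Simplex

/-! ### Comparison of the three invariants -/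

section Invariants

variable {n : ℕ} {P : Set (Fin n → ℝ)}

/-- A polytope has a vertex, and its shifted vertex is a point of the shrunken polytope. -/
theorem nefSet_subset_codegQSet (hP : IsFullDimLatticePolytope P) : nefSet P ⊆ codegQSet P := by
  rintro _ ⟨a, b, ha, hb, hspanned, rfl⟩
  refine ⟨a, b, ha, hb, ?_, rfl⟩
  have ha' : (a : ℝ) ≠ 0 := by exact_mod_cast ha.ne'
  obtain ⟨m, hm⟩ := hP.extremePoints_nonempty
  have hm' := image_extremePoints (LinearEquiv.smulOfNeZero ℝ (Fin n → ℝ) (a : ℝ) ha') P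
  obtain ⟨y, hy, -⟩ := hspanned ((a : ℝ) • m) (hm'.subset ⟨m, hm, rfl⟩)
  exact ⟨y, hy⟩

theorem bddBelow_codegQSet : BddBelow (codegQSet P) := by
  refine ⟨0, ?_⟩
  rintro _ ⟨a, b, -, -, -, rfl⟩
  positivity

theorem natCast_mem_codegQSet {k : ℕ} (hk : k ∈ codegSet P) : (k : ℝ) ∈ codegQSet P := by
  obtain ⟨hk0, z, hz⟩ := hk
  exact ⟨k, 1, hk0, one_pos, ⟨_, hz⟩, by simp⟩

theorem succ_mem_nefSet (hP : IsFullDimLatticePolytope P) (hs : IsSmooth P) :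
    (n : ℝ) + 1 ∈ nefSet P :=
  ⟨n + 1, 1, n.succ_pos, one_pos, isSpanned_smul_succ hP hs, by simp⟩

theorem succ_mem_codegSet (hP : IsFullDimLatticePolytope P) (hs : IsSmooth P) :
    n + 1 ∈ codegSet P := by
  refine ⟨n.succ_pos, ?_⟩
  have hn0 : ((n + 1 : ℕ) : ℝ) ≠ 0 := by exact_mod_cast n.succ_ne_zero
  obtain ⟨m, hm⟩ := hP.extremePoints_nonempty
  obtain ⟨b, u, hb, hu, -⟩ := hs.exists_coordinates hP hm
  have hm' := image_extremePoints (LinearEquiv.smulOfNeZero ℝ (Fin n → ℝ) ((n + 1 : ℕ) : ℝ) hn0) P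
  obtain ⟨y, hy, hym⟩ := isSpanned_smul_succ hP hs (((n + 1 : ℕ) : ℝ) • m)
    (hm'.subset ⟨m, hm, rfl⟩)
  obtain ⟨z, rfl⟩ := exists_toReal_eq_of_mem_extremePoints hP hm
  -- The witness of spannedness is determined by its pairings with the basis `b`, so it equals this
  -- lattice point.
  refine ⟨((n + 1 : ℕ) : ℤ) • z + ∑ j, u j, ?_⟩
  convert hy using 1
  refine eq_of_pairing_basis_eq b fun i => ?_
  rw [hym (b i) (by
    rw [normalsAt_smul (by positivity), ← hb]; exact Set.mem_range_self i), toReal_add,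
    toReal_smul, pairing_add, toReal_sum, pairing_sum]
  simp [pairing_dual hu]

end Invariants

end LatticePolytope

open LatticePolytope in
theorem corollary2p3 (n : ℕ) (hn : 1 ≤ n) (P : Set (Fin n → ℝ))
    (hP : LatticePolytope.IsFullDimLatticePolytope P) (hsmooth : LatticePolytope.IsSmooth P) :
    -- the minimum and the two infima below are taken over non-empty sets
    (LatticePolytope.codegSet P).Nonempty ∧
    (LatticePolytope.codegQSet P).Nonempty ∧
    (LatticePolytope.nefSet P).Nonempty ∧
    ((LatticePolytope.codeg P = n + 1 ∧ LatticePolytope.codegQ P = n + 1 ∧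
        LatticePolytope.nefValue P = n + 1) ↔
      LatticePolytope.LatticeEquivalent P (LatticePolytope.unitSimplex n)) ∧
    (¬ LatticePolytope.LatticeEquivalent P (LatticePolytope.unitSimplex n) →
      LatticePolytope.codegQ P ≤ LatticePolytope.nefValue P ∧
        LatticePolytope.nefValue P ≤ n) := by
  have hnef := succ_mem_nefSet hP hsmooth
  have hQ := nefSet_subset_codegQSet hP hnef
  have hcod := succ_mem_codegSet hP hsmooth
  have hbdd := bddBelow_codegQSet (P := P)
  have hbdd' := hbdd.mono (nefSet_subset_codegQSet hP)
  have hmain : ¬ LatticeEquivalent P (unitSimplex n) → nefValue P ≤ n := fun hne =>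
    csInf_le hbdd' ⟨n, 1, hn, one_pos, isSpanned_smul_dim hP hsmooth hn hne, by simp⟩
  refine ⟨⟨_, hcod⟩, ⟨_, hQ⟩, ⟨_, hnef⟩, ⟨fun h => ?_, fun h => ?_⟩, fun hne =>
    ⟨csInf_le_csInf hbdd ⟨_, hnef⟩ (nefSet_subset_codegQSet hP), hmain hne⟩⟩
  -- The nef value alone decides: it would be both `n + 1` and at most `n`.
  · by_contra hne
    have := hmain hne
    rw [h.2.2] at this
    linarith
  · have hle := fun q (hq : q ∈ codegQSet P) => h.le_of_mem_codegQSet hn hq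
    refine ⟨le_antisymm (Nat.sInf_le hcod) ?_, le_antisymm (csInf_le hbdd hQ) (le_csInf ⟨_, hQ⟩ hle),
      le_antisymm (csInf_le hbdd' hnef)
        (le_csInf ⟨_, hnef⟩ fun q hq => hle q (nefSet_subset_codegQSet hP hq))⟩
    exact_mod_cast hle _ (natCast_mem_codegQSet (Nat.sInf_mem ⟨_, hcod⟩))
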